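/- **Setting.** Featherweight Java expressions are $e ::= x \mid \mathtt{this} \mid e.f \mid e.m(\overline e) \mid \mathtt{new}\ C(\overline e) \mid (C)e$, and a method declaration is $M = C_0\ m(\overline C\ \overline x)\{\mathtt{return}\ e\}$. A *class table* $CT$ is a finite set of clauses $C\ \mathtt{extends}\ D$, $C.\mathit{init}(\overline D)$, $C.f:D$, $C.m:\overline D\to D$. Put $\mathrm{ext}(CT)=\{(C,D) : (C\ \mathtt{extends}\ D)\in CT\}$. For a finite binary relation $\Sigma$ on class names, $<:_\Sigma$ is its reflexive transitive closure; under $CT$, $<:$ means $<:_{\mathrm{ext}(CT)}$. **Contextual typing.** $\mathrm{extends}(C,CT)=D$ means $(C\ \mathtt{extends}\ D)\in CT$; $\mathrm{fields}(C,CT)=C.\mathit{init}(\overline D)$ means that this constructor clause is in $CT$; $\mathrm{field}(f,C,CT)$ and $\mathrm{mtype}(m,C,CT)$ are given by the clause for $f$, resp. $m$, of $C$ itself if there is one, and otherwise by lookup in a direct superclass of $C$. The judgment $\Gamma;CT\vdash e:C$ is given by the usual rules: variables and $\mathtt{this}$ by lookup in $\Gamma$; $e.f$ by $\mathrm{field}$;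 $e.m(\overline e)$ by $\mathrm{mtype}$ and $\mathtt{new}\ C(\overline e)$ by $\mathrm{fields}$, the argument types being subtypes of the parameter types; and $(C)e$ has type $C$ for $e:D$ by an upcast ($D<:C$), a downcast ($C<:D$, $C\neq D$) or a stupid cast (neither is a subtype of the other). The method $M$ *is OK in $C$ under $CT$* if $\overline x:\overline C,\mathtt{this}:C;CT\vdash e:E_0$ with $E_0<:C_0$, and for some $D$ with $\mathrm{extends}(C,CT)=D$: whenever $\mathrm{mtype}(m,D,CT)=\overline D\to D_0$, then $\overline D=\overline C$ and $D_0=C_0$. **Co-contextual typing.** A class type $T$ is a class name (*ground*) or one of countably many class variables $U$. Constraints are $T=T'$, $T\ne T'$, $T<:T'$, $T\not<:T'$, and $T=T'\ \mathrm{if}\ \mathit{cond}$, where a condition is a finite set (conjunction) of equations and inequations of class types. Class table requirements $CR$ are finite sets of pairs $(\mathit{CReq},\mathit{cond})$ with $\mathit{CReq}$ of the form $T.\mathtt{extends}:T'$, $T.\mathit{init}(\overline T)$, $T.f:T'$, $T.m:\overline T\to T'$ or optional $(T.m:\overline T\to T')_{opt}$. Two requirements *overlap* if both are $\mathtt{extends}$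 requirements, both are constructor requirements, both concern the same field name, or both concern the same method name (optional or not). $\mathrm{merge}_{CR}(CR_1,CR_2)=CR|_S$ keeps the requirements that overlap with none of the other set; for each overlapping pair $(r_1,c_1)\in CR_1$, $(r_2,c_2)\in CR_2$ with receivers $T_1,T_2$ it has $(r_1,c_1\cup\{T_1\neq T_2\})$, $(r_2,c_2\cup\{T_1\neq T_2\})$ and $(r_1,c_1\cup c_2\cup\{T_1=T_2\})$ in $CR$ (with $r_2$ in place of $r_1$ in the last if $r_1$ is optional and $r_2$ is not), and in $S$ the constraints that the signatures of $r_1,r_2$ are equal if $T_1=T_2$ (sequences of different lengths being unequal). Context requirements $R$ are finite partial maps from variables and $\mathtt{this}$ to class types; $\mathrm{merge}_R$ takes their (left-biased) union, with the constraints $R_1(x)=R_2(x)$ for $x$ in both domains. More than two arguments are merged successively. The judgment $e:T\mid S\mid R\mid CR$ is given by the following rules, in which all introduced class variables are fresh, independent subderivations use disjoint class variables, and the constraints of the subderivations and of all merges are included in $S$; the requirements of the subderivations are merged. - $x$ (or $\mathtt{this}$) has type a fresh $U$, with $R=\{x:U\}$ and $S=CR=\emptyset$. - $e.f$ has type a fresh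 $U$, and $(T_e.f:U,\emptyset)$ is merged into $CR_e$. - $e.m(\overline e)$ has type a fresh $U'$, for fresh $\overline U$; $(T_e.m:\overline U\to U',\emptyset)$ is merged in and the constraints $\overline T<:\overline U$ are added. - $\mathtt{new}\ C(\overline e)$ has type $C$, for fresh $\overline U$; $(C.\mathit{init}(\overline U),\emptyset)$ is merged in and $\overline T<:\overline U$ are added. - $(C)e$ has type $C$, adding $\{T_e<:C\}$, or $\{C<:T_e,\ C\neq T_e\}$, or $\{C\not<:T_e,\ T_e\not<:C\}$. The method $M$ *is OK co-contextually with $(S,T,CR)$* if $e:T_e\mid S_e\mid R_e\mid CR_e$, the domain of $R_e$ consists of $\mathtt{this}$ and parameters in $\overline x$ at most, $T=U_c$ for distinct fresh $U_c,U_d$, $CR|_{S_{cr}}=\mathrm{merge}_{CR}(CR_e,(U_c.\mathtt{extends}:U_d,\emptyset),(U_d.m:\overline C\to C_0,\emptyset)_{opt})$, and $S=S_e\cup\{T_e<:C_0\}\cup\{U_c=R_e(\mathtt{this})\mid\mathtt{this}\in\mathrm{dom}\,R_e\}\cup S_{cr}\cup\{C_i=R_e(x_i)\mid x_i\in\mathrm{dom}\,R_e\}$.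 **Solutions and satisfaction.** A substitution $\sigma$ maps class variables to class types. $\mathrm{solve}(\Sigma,S)=\sigma$ means that $\sigma$ satisfies every constraint in $S$, with $<:$ read as $<:_\Sigma$ on class names. $\sigma$ is *ground* for $(T,CR)$ if all class types in $\sigma(T)$ and $\sigma(CR)$, conditions included, are ground. $CT$ *satisfies* $\sigma(CR)$ if for every $(\mathit{CReq},\mathit{cond})\in\sigma(CR)$ whose condition holds: $\mathrm{extends}(C,CT)=D$ for $C.\mathtt{extends}:D$; $\mathrm{fields}(C,CT)=C.\mathit{init}(\overline D)$ for $C.\mathit{init}(\overline D)$; $\mathrm{field}(f,C,CT)=D$ for $C.f:D$; $\mathrm{mtype}(m,C,CT)=\overline D\to D$ for $C.m:\overline D\to D$; and for $(C.m:\overline D\to D)_{opt}$, if $m$ has a type $\mathrm{mtype}(m,C,CT)$ at all, then it is $\overline D\to D$. **Theorem.** Let $M$ be a method declaration that is OK co-contextually with $(S,T,CR)$, let $\Sigma$ be a finite binary relation on class names, and let $\sigma$ be a substitution with $\mathrm{solve}(\Sigma,S)=\sigma$ that is ground for $(T,CR)$. Assume that $\Sigma$ contains the immediate subclass relations that are required,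 that is, $(C,D)\in\Sigma$ for every requirement $(C.\mathtt{extends}:D,\mathit{cond})\in\sigma(CR)$ whose condition holds. Then there exist a class name $C$ and a class table $CT$, with at most one constructor clause for each class, at most one clause for each field of a class and at most one clause for each method of a class, such that $\mathrm{ext}(CT)=\Sigma$, $M$ is OK in $C$ under $CT$, $\sigma(T)=C$, and $CT$ satisfies $\sigma(CR)$. -/

import Mathlib

namespace CoFJ

/-! ### Names, types and syntax -/

abbrev ClassName := String
abbrev FieldName := String
abbrev MethodName := String
abbrev VarName := String

/-- Class variables: countably many, with decidable equality. -/
abbrev ClassVar := ℕ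

/-- Class types: class names (the ground types) or class variables. -/
inductive Ty where
  | cls (C : ClassName)
  | var (U : ClassVar)
  deriving DecidableEq

/-- What a context binds: the self reference or a method parameter. -/
inductive Ref where
  | this
  | param (x : VarName)
  deriving DecidableEq

/-- Featherweight Java expressions. -/
inductive Expr where
  | ref (x : Ref)
  | field (e : Expr) (f : FieldName)
  | invk (e : Expr) (m : MethodName) (es : List Expr)
  | new (C : ClassName) (es : List Expr)
  | cast (C : ClassName) (e : Expr)

/-- A method declaration `ret name(params) { return body; }`. -/
structure MethodDecl where
  ret : ClassName
  name : MethodName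
  params : List (VarName × ClassName)
  body : Expr

/-- The annotated parameter types of a method. -/
def MethodDecl.paramTypes (M : MethodDecl) : List ClassName := M.params.map Prod.snd

/-! ### Class tables and contextual Featherweight Java -/

/-- Class table clauses. -/
inductive Clause where
  | ext (C D : ClassName)
  | ctor (C : ClassName) (Ds : List ClassName)
  | field (C : ClassName) (f : FieldName) (D : ClassName)
  | meth (C : ClassName) (m : MethodName) (Ds : List ClassName) (D : ClassName)
  deriving DecidableEq

/-- A class table is a finite set of clauses. -/
abbrev ClassTable := Finset Clause

/-- A finite immediate-subclass relation: `(C, D)` says that `C` directly extends `D`. -/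
abbrev SubclassRel := Finset (ClassName × ClassName)

/-- The extends clauses of a single clause, as a relation. -/
def Clause.ext? : Clause → SubclassRel
  | .ext C D => {(C, D)}
  | _ => ∅

/-- The immediate-subclass relation of a class table. -/
def ClassTable.extRel (CT : ClassTable) : SubclassRel := CT.biUnion Clause.ext?

/-- Each constructor, each field of a class and each method of a class has at most one clause.
Uniqueness of the direct superclass is a property of `CT.extRel` alone. -/
structure ClassTable.Consistent (CT : ClassTable) : Prop where
  ctor : ∀ C Ds Ds', Clause.ctor C Ds ∈ CT → Clause.ctor C Ds' ∈ CT → Ds = Ds'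
  field : ∀ C f D D', Clause.field C f D ∈ CT → Clause.field C f D' ∈ CT → D = D'
  meth : ∀ C m Ds Ds' D D', Clause.meth C m Ds D ∈ CT → Clause.meth C m Ds' D' ∈ CT →
    Ds = Ds' ∧ D = D'

/-- Subtyping relative to a subclass relation: its reflexive transitive closure. -/
def IsSubtype (Sg : SubclassRel) : ClassName → ClassName → Prop :=
  Relation.ReflTransGen (fun C D => (C, D) ∈ Sg)

/-- `extends(C, CT) = D`. -/
def Extends (CT : ClassTable) (C D : ClassName) : Prop := Clause.ext C D ∈ CT

/-- `fields(C, CT) = C.init(Ds)`: the constructor signature of `C`. -/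
def Fields (CT : ClassTable) (C : ClassName) (Ds : List ClassName) : Prop :=
  Clause.ctor C Ds ∈ CT

/-- `field(f, C, CT) = D`: the declaration of `f` in the nearest superclass of `C`. -/
inductive FieldLookup (CT : ClassTable) (f : FieldName) : ClassName → ClassName → Prop
  | here {C D : ClassName} : Clause.field C f D ∈ CT → FieldLookup CT f C D
  | up {C C' D : ClassName} : (∀ E, Clause.field C f E ∉ CT) → Extends CT C C' →
      FieldLookup CT f C' D → FieldLookup CT f C D

/-- `mtype(m, C, CT) = Ds → D`: the declaration of `m` in the nearest superclass of `C`. -/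
inductive MType (CT : ClassTable) (m : MethodName) :
    ClassName → List ClassName → ClassName → Prop
  | here {C : ClassName} {Ds : List ClassName} {D : ClassName} :
      Clause.meth C m Ds D ∈ CT → MType CT m C Ds D
  | up {C C' : ClassName} {Ds : List ClassName} {D : ClassName} :
      (∀ Es E, Clause.meth C m Es E ∉ CT) → Extends CT C C' →
      MType CT m C' Ds D → MType CT m C Ds D

/-- Typing contexts. -/
abbrev Ctx := Ref → Option ClassName

/-- Expression typing of Featherweight Java, `Γ; CT ⊢ e : C`. -/
inductive HasType (CT : ClassTable) (Γ : Ctx) : Expr → ClassName → Prop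
  | ref {x : Ref} {C : ClassName} : Γ x = some C → HasType CT Γ (.ref x) C
  | field {e : Expr} {f : FieldName} {Ce C : ClassName} :
      HasType CT Γ e Ce → FieldLookup CT f Ce C → HasType CT Γ (.field e f) C
  | invk {e : Expr} {m : MethodName} {es : List Expr} {Ce C : ClassName}
      {Cs Ds : List ClassName} :
      HasType CT Γ e Ce →
      es.length = Cs.length → (∀ p ∈ es.zip Cs, HasType CT Γ p.1 p.2) →
      MType CT m Ce Ds C → List.Forall₂ (IsSubtype CT.extRel) Cs Ds →
      HasType CT Γ (.invk e m es) C
  | new {C : ClassName} {es : List Expr} {Cs Ds : List ClassName} :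
      es.length = Cs.length → (∀ p ∈ es.zip Cs, HasType CT Γ p.1 p.2) →
      Fields CT C Ds → List.Forall₂ (IsSubtype CT.extRel) Cs Ds →
      HasType CT Γ (.new C es) C
  | ucast {C D : ClassName} {e : Expr} :
      HasType CT Γ e D → IsSubtype CT.extRel D C → HasType CT Γ (.cast C e) C
  | dcast {C D : ClassName} {e : Expr} :
      HasType CT Γ e D → IsSubtype CT.extRel C D → C ≠ D → HasType CT Γ (.cast C e) C
  | scast {C D : ClassName} {e : Expr} :
      HasType CT Γ e D → ¬ IsSubtype CT.extRel C D → ¬ IsSubtype CT.extRel D C →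
      HasType CT Γ (.cast C e) C

/-- The context binding the parameters of `M` and `this`. -/
def MethodDecl.ctx (M : MethodDecl) (C : ClassName) : Ctx
  | .this => some C
  | .param x => M.params.lookup x

/-- Method typing of Featherweight Java: `C; CT ⊢ M OK`. -/
def MethodOK (CT : ClassTable) (C : ClassName) (M : MethodDecl) : Prop :=
  ∃ E₀ D : ClassName,
    HasType CT (M.ctx C) M.body E₀ ∧ IsSubtype CT.extRel E₀ M.ret ∧
    Extends CT C D ∧
    ∀ Ds D₀, MType CT M.name D Ds D₀ → M.paramTypes = Ds ∧ M.ret = D₀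

/-! ### Constraints, conditions and requirements -/

/-- Atomic conditions. -/
inductive CondAtom where
  | eq (t t' : Ty)
  | neq (t t' : Ty)
  deriving DecidableEq

/-- A condition is a finite conjunction of atomic conditions. -/
abbrev Cond := Finset CondAtom

/-- Constraints on class types. -/
inductive Constraint where
  | eq (t t' : Ty)
  | neq (t t' : Ty)
  | sub (t t' : Ty)
  | nsub (t t' : Ty)
  | eqIf (t t' : Ty) (c : Cond)

/-- Class requirements: superclass, constructor, field, method and optional method. -/
inductive CReq where
  | ext (t t' : Ty)
  | ctor (t : Ty) (ts : List Ty)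
  | field (t : Ty) (f : FieldName) (t' : Ty)
  | meth (t : Ty) (m : MethodName) (ts : List Ty) (t' : Ty)
  | optMeth (t : Ty) (m : MethodName) (ts : List Ty) (t' : Ty)
  deriving DecidableEq

/-- Class table requirements: a finite set of conditional class requirements. -/
abbrev ClassReqs := Finset (CReq × Cond)

/-- Context requirements: required types of parameters and of `this`. -/
abbrev CtxReqs := Ref → Option Ty

/-! ### Merging -/

/-- The constraint that two context requirements agree where both are defined. -/
def mergeRConstraints (R₁ R₂ : CtxReqs) : Set Constraint :=
  {s | ∃ x t₁ t₂, R₁ x = some t₁ ∧ R₂ x = some t₂ ∧ s = .eq t₁ t₂}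

/-- The union of two context requirements, which takes the first entry where both are defined. -/
def mergeR (R₁ R₂ : CtxReqs) : CtxReqs := fun x => (R₁ x).or (R₂ x)

/-- Iterated merging of context requirements, starting from `R`. -/
def mergeRFrom (R : CtxReqs) : List CtxReqs → CtxReqs × Set Constraint
  | [] => (R, ∅)
  | R' :: Rs =>
      ((mergeRFrom (mergeR R R') Rs).1,
        mergeRConstraints R R' ∪ (mergeRFrom (mergeR R R') Rs).2)

def mergeRs (Rs : List CtxReqs) : CtxReqs × Set Constraint := mergeRFrom (fun _ => none) Rs

/-- The receiver of a class requirement. -/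
def CReq.recv : CReq → Ty
  | .ext t _ => t
  | .ctor t _ => t
  | .field t _ _ => t
  | .meth t _ _ _ => t
  | .optMeth t _ _ _ => t

/-- Which entry of the receiver a class requirement is about. -/
inductive MemberKey where
  | ext
  | ctor
  | field (f : FieldName)
  | meth (m : MethodName)
  deriving DecidableEq

/-- Optional and ordinary requirements on a method concern the same entry. -/
def CReq.key : CReq → MemberKey
  | .ext _ _ => .ext
  | .ctor _ _ => .ctor
  | .field _ f _ => .field f
  | .meth _ m _ _ => .meth m
  | .optMeth _ m _ _ => .meth m

/-- The required signature, as the sequence of its types, the result type coming first. -/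
def CReq.signature : CReq → List Ty
  | .ext _ t' => [t']
  | .ctor _ ts => ts
  | .field _ _ t' => [t']
  | .meth _ _ ts t' => t' :: ts
  | .optMeth _ _ ts t' => t' :: ts

/-- `ts = ts' if t = t'` for sequences. Sequences of different lengths are never equal, so for
these the constraint says `t ≠ t'`. -/
def seqEqIf (ts ts' : List Ty) (t t' : Ty) : Set Constraint :=
  if ts.length = ts'.length then
    {s | ∃ p ∈ ts.zip ts', s = .eqIf p.1 p.2 {.eq t t'}}
  else {.neq t t'}

/-- The requirement that remains of two requirements with the same entry and equal receivers:
the first one, except that an ordinary method requirement prevails over an optional one. -/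
def CReq.keep : CReq → CReq → CReq
  | .optMeth _ _ _ _, .meth t m ts t' => .meth t m ts t'
  | r, _ => r

/-- What two overlapping conditional requirements become by merging. -/
def mergePair (a b : CReq × Cond) : ClassReqs :=
  {(a.1, insert (.neq a.1.recv b.1.recv) a.2),
   (b.1, insert (.neq a.1.recv b.1.recv) b.2),
   (a.1.keep b.1, insert (.eq a.1.recv b.1.recv) (a.2 ∪ b.2))}

/-- Merging of class table requirements: requirements on an entry that does not occur on the other
side are kept, overlapping ones are merged pairwise. -/
def mergeCR (A B : ClassReqs) : ClassReqs :=
  A.filter (fun a => ∀ b ∈ B, a.1.key ≠ b.1.key) ∪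
  B.filter (fun b => ∀ a ∈ A, a.1.key ≠ b.1.key) ∪
  ((A ×ˢ B).filter (fun p => p.1.1.key = p.2.1.key)).biUnion (fun p => mergePair p.1 p.2)

/-- The constraints generated by merging class table requirements. -/
def mergeCRConstraints (A B : ClassReqs) : Set Constraint :=
  {s | ∃ a ∈ A, ∃ b ∈ B, a.1.key = b.1.key ∧
    s ∈ seqEqIf a.1.signature b.1.signature a.1.recv b.1.recv}

/-- Iterated merging of class table requirements, starting from `A`. -/
def mergeCRFrom (A : ClassReqs) : List ClassReqs → ClassReqs × Set Constraint
  | [] => (A, ∅)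
  | B :: Bs =>
      ((mergeCRFrom (mergeCR A B) Bs).1,
        mergeCRConstraints A B ∪ (mergeCRFrom (mergeCR A B) Bs).2)

def mergeCRs (CRs : List ClassReqs) : ClassReqs × Set Constraint := mergeCRFrom ∅ CRs

/-! ### Co-contextual typing -/

/-- The output of co-contextual expression typing, `e : T | S | R | CR`. The set `vars` consists of
the class variables introduced in the derivation. Source expressions contain no class variables, so
a class variable is fresh for a derivation if and only if it is not in `vars`. -/
structure Output where
  ty : Ty
  cons : Set Constraint
  reqs : CtxReqs
  creqs : ClassReqs
  vars : Finset ClassVar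

/-- The class variables introduced in a sequence of derivations. -/
def allVars (os : List Output) : Finset ClassVar := os.foldr (fun o V => o.vars ∪ V) ∅

/-- The union of the constraints of a sequence of derivations. -/
def allCons (os : List Output) : Set Constraint := {s | ∃ o ∈ os, s ∈ o.cons}

/-- The derivations introduce pairwise disjoint sets of class variables. -/
def Independent (os : List Output) : Prop := os.Pairwise (fun o o' => Disjoint o.vars o'.vars)

/-- The constraints that the types of the arguments are subtypes of the variables `Us`. -/
def argCons (os : List Output) (Us : List ClassVar) : Set Constraint :=
  {s | ∃ p ∈ os.zip Us, s = .sub p.1.ty (.var p.2)}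

/-- Co-contextual expression typing. -/
inductive CoExpr : Expr → Output → Prop
  | ref {x : Ref} {U : ClassVar} :
      CoExpr (.ref x)
        { ty := .var U, cons := ∅, reqs := fun y => if y = x then some (.var U) else none,
          creqs := ∅, vars := {U} }
  | field {e : Expr} {f : FieldName} {o : Output} {U : ClassVar} :
      CoExpr e o → U ∉ o.vars →
      CoExpr (.field e f)
        { ty := .var U
          cons := o.cons ∪ (mergeCRs [o.creqs, {(.field o.ty f (.var U), ∅)}]).2
          reqs := o.reqs
          creqs := (mergeCRs [o.creqs, {(.field o.ty f (.var U), ∅)}]).1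
          vars := insert U o.vars }
  | invk {e : Expr} {m : MethodName} {es : List Expr} {o : Output} {os : List Output}
      {U' : ClassVar} {Us : List ClassVar} {crs : List ClassReqs} :
      CoExpr e o →
      es.length = os.length → (∀ p ∈ es.zip os, CoExpr p.1 p.2) →
      Independent (o :: os) →
      Us.length = es.length → (U' :: Us).Nodup → (∀ U ∈ U' :: Us, U ∉ allVars (o :: os)) →
      crs = o.creqs :: {(CReq.meth o.ty m (Us.map Ty.var) (.var U'), ∅)} ::
        os.map Output.creqs →
      CoExpr (.invk e m es)
        { ty := .var U'
          cons := allCons os ∪ o.cons ∪ argCons os Us ∪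
            (mergeRs (o.reqs :: os.map Output.reqs)).2 ∪ (mergeCRs crs).2
          reqs := (mergeRs (o.reqs :: os.map Output.reqs)).1
          creqs := (mergeCRs crs).1
          vars := allVars (o :: os) ∪ (U' :: Us).toFinset }
  | new {C : ClassName} {es : List Expr} {os : List Output} {Us : List ClassVar}
      {crs : List ClassReqs} :
      es.length = os.length → (∀ p ∈ es.zip os, CoExpr p.1 p.2) →
      Independent os →
      Us.length = es.length → Us.Nodup → (∀ U ∈ Us, U ∉ allVars os) →
      crs = {(CReq.ctor (.cls C) (Us.map Ty.var), ∅)} :: os.map Output.creqs →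
      CoExpr (.new C es)
        { ty := .cls C
          cons := allCons os ∪ argCons os Us ∪
            (mergeRs (os.map Output.reqs)).2 ∪ (mergeCRs crs).2
          reqs := (mergeRs (os.map Output.reqs)).1
          creqs := (mergeCRs crs).1
          vars := allVars os ∪ Us.toFinset }
  | ucast {C : ClassName} {e : Expr} {o : Output} :
      CoExpr e o →
      CoExpr (.cast C e)
        { o with ty := .cls C, cons := o.cons ∪ {.sub o.ty (.cls C)} }
  | dcast {C : ClassName} {e : Expr} {o : Output} :
      CoExpr e o →
      CoExpr (.cast C e)
        { o with ty := .cls C, cons := o.cons ∪ {.sub (.cls C) o.ty} ∪ {.neq (.cls C) o.ty} }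
  | scast {C : ClassName} {e : Expr} {o : Output} :
      CoExpr e o →
      CoExpr (.cast C e)
        { o with ty := .cls C, cons := o.cons ∪ {.nsub (.cls C) o.ty} ∪ {.nsub o.ty (.cls C)} }

/-- The constraints that the annotated parameter types agree with the required ones. -/
def paramCons (M : MethodDecl) (R : CtxReqs) : Set Constraint :=
  {s | ∃ p ∈ M.params, ∃ t, R (.param p.1) = some t ∧ s = .eq (.cls p.2) t}

/-- The constraint that the enclosing class agrees with the required type of `this`. -/
def thisCons (Uc : ClassVar) (R : CtxReqs) : Set Constraint :=
  {s | ∃ t, R .this = some t ∧ s = .eq (.var Uc) t}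

/-- Co-contextual method typing, `M OK | S | T | CR`. -/
inductive CoMethod : MethodDecl → Set Constraint → Ty → ClassReqs → Prop
  | intro {M : MethodDecl} {o : Output} {Uc Ud : ClassVar} {crs : List ClassReqs} :
      CoExpr M.body o →
      (∀ x, o.reqs (.param x) ≠ none → x ∈ M.params.map Prod.fst) →
      Uc ∉ o.vars → Ud ∉ o.vars → Uc ≠ Ud →
      crs = [o.creqs, {(CReq.ext (.var Uc) (.var Ud), ∅)},
        {(CReq.optMeth (.var Ud) M.name (M.paramTypes.map Ty.cls) (.cls M.ret), ∅)}] →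
      CoMethod M
        (o.cons ∪ {.sub o.ty (.cls M.ret)} ∪ thisCons Uc o.reqs ∪ (mergeCRs crs).2 ∪
          paramCons M o.reqs)
        (.var Uc) (mergeCRs crs).1

/-! ### Substitutions and solutions -/

/-- Substitutions; a variable without a binding is mapped to itself. -/
abbrev Subst := ClassVar → Ty

def Ty.subst (σ : Subst) : Ty → Ty
  | .cls C => .cls C
  | .var U => σ U

def CondAtom.subst (σ : Subst) : CondAtom → CondAtom
  | .eq t t' => .eq (t.subst σ) (t'.subst σ)
  | .neq t t' => .neq (t.subst σ) (t'.subst σ)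

def Cond.subst (σ : Subst) (c : Cond) : Cond := c.image (CondAtom.subst σ)

def CReq.subst (σ : Subst) : CReq → CReq
  | .ext t t' => .ext (t.subst σ) (t'.subst σ)
  | .ctor t ts => .ctor (t.subst σ) (ts.map (Ty.subst σ))
  | .field t f t' => .field (t.subst σ) f (t'.subst σ)
  | .meth t m ts t' => .meth (t.subst σ) m (ts.map (Ty.subst σ)) (t'.subst σ)
  | .optMeth t m ts t' => .optMeth (t.subst σ) m (ts.map (Ty.subst σ)) (t'.subst σ)

def ClassReqs.subst (σ : Subst) (CR : ClassReqs) : ClassReqs :=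
  CR.image (fun r => (r.1.subst σ, Cond.subst σ r.2))

def Ty.Ground (t : Ty) : Prop := ∃ C, t = .cls C

def CondAtom.Ground : CondAtom → Prop
  | .eq t t' => t.Ground ∧ t'.Ground
  | .neq t t' => t.Ground ∧ t'.Ground

def CReq.Ground (r : CReq) : Prop := r.recv.Ground ∧ ∀ t ∈ r.signature, t.Ground

def ClassReqs.Ground (CR : ClassReqs) : Prop :=
  ∀ r ∈ CR, r.1.Ground ∧ ∀ a ∈ r.2, a.Ground

def CondAtom.Holds : CondAtom → Prop
  | .eq t t' => t = t'
  | .neq t t' => t ≠ t'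

def Cond.Holds (c : Cond) : Prop := ∀ a ∈ c, a.Holds

/-- Subtyping of class types: both are class names that are in the subtype relation. -/
def Ty.Sub (Sg : SubclassRel) (t t' : Ty) : Prop :=
  ∃ C D, t = .cls C ∧ t' = .cls D ∧ IsSubtype Sg C D

/-- Constraint satisfaction. -/
def Sat (Sg : SubclassRel) (σ : Subst) : Constraint → Prop
  | .eq t t' => t.subst σ = t'.subst σ
  | .neq t t' => t.subst σ ≠ t'.subst σ
  | .sub t t' => Ty.Sub Sg (t.subst σ) (t'.subst σ)
  | .nsub t t' => ¬ Ty.Sub Sg (t.subst σ) (t'.subst σ)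
  | .eqIf t t' c => Cond.Holds (Cond.subst σ c) → t.subst σ = t'.subst σ

/-- `σ` is a solution of `S` relative to `Sg`. -/
def Solves (Sg : SubclassRel) (S : Set Constraint) (σ : Subst) : Prop := ∀ s ∈ S, Sat Sg σ s

/-- A class table satisfies a (ground) class requirement. -/
def SatisfiesReq (CT : ClassTable) : CReq → Prop
  | .ext t t' => ∃ C D, t = .cls C ∧ t' = .cls D ∧ Extends CT C D
  | .ctor t ts => ∃ C Ds, t = .cls C ∧ ts = Ds.map Ty.cls ∧ Fields CT C Ds
  | .field t f t' => ∃ C D, t = .cls C ∧ t' = .cls D ∧ FieldLookup CT f C D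
  | .meth t m ts t' =>
      ∃ C Ds D, t = .cls C ∧ ts = Ds.map Ty.cls ∧ t' = .cls D ∧ MType CT m C Ds D
  | .optMeth t m ts t' =>
      ∃ C, t = .cls C ∧ ∀ Ds D, MType CT m C Ds D → ts = Ds.map Ty.cls ∧ t' = .cls D

/-- A class table satisfies (ground) class table requirements: it satisfies those whose condition
holds. -/
def Satisfies (CT : ClassTable) (CR : ClassReqs) : Prop :=
  ∀ r ∈ CR, Cond.Holds r.2 → SatisfiesReq CT r.1

/-- The superclasses that (ground) class table requirements ask for are the ones given by `Sg`. -/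
def InheritanceIn (Sg : SubclassRel) (CR : ClassReqs) : Prop :=
  ∀ r ∈ CR, Cond.Holds r.2 → ∀ C D, r.1 = .ext (.cls C) (.cls D) → (C, D) ∈ Sg

end CoFJ

namespace CoFJ

/-! ### Entries: what a requirement or a clause says about a class -/

/-! The class table is read off the requirements. It has the superclass clauses of `Sg` and, for
every requirement whose condition holds under `σ`, a clause declaring the required member in the
receiver itself. Every lookup then stops at the receiver, so inheritance plays no role in typing,
and the only danger is that two such clauses conflict. Optional methods are declared too: the one
required of the superclass of `C` thereby fixes its method type, which is the override condition of
`MethodOK`.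

It remains to see that merging neither loses requirements nor lets conflicting ones through. An
`Entry` forgets whether a method requirement is optional, so `CReq.keep` does not change entries.
The merge constraints make two overlapping requirements with equal receivers have the same entry,
whether or not their conditions hold; this gives `Coherent`. A requirement could get lost only when
an active one meets an inactive one on the same member, since then all three results of `mergePair`
are inactive. `Covered` excludes this: the inactive one has an active companion on its side, and the
merge with that companion survives. Hence merging acts on active entries as union
(`activeEntries_mergeCR`) and preserves both invariants.

Consequently a table providing the final entries provides those of every subderivation, and
`CoExpr.hasType` follows by induction. The types it meets are ground because they come from the
context, from clauses, or from class names in the source. -/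

/-- A receiver, one of its members, and the signature of that member. -/
abbrev Entry := Ty × MemberKey × List Ty

/-- The entry that a class requirement asks for. -/
def CReq.entry (r : CReq) : Entry := (r.recv, r.key, r.signature)

/-- The entry that a class table clause provides. -/
def Clause.entry : Clause → Entry
  | .ext C D => (.cls C, .ext, [.cls D])
  | .ctor C Ds => (.cls C, .ctor, Ds.map .cls)
  | .field C f D => (.cls C, .field f, [.cls D])
  | .meth C m Ds D => (.cls C, .meth m, .cls D :: Ds.map .cls)

/-- The class name of a ground class type. -/
def Ty.name : Ty → ClassName
  | .cls C => C
  | .var _ => default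

/-- The clause that declares exactly what a ground requirement asks for. -/
def CReq.toClause : CReq → Clause
  | .ext t t' => .ext t.name t'.name
  | .ctor t ts => .ctor t.name (ts.map Ty.name)
  | .field t f t' => .field t.name f t'.name
  | .meth t m ts t' => .meth t.name m (ts.map Ty.name) t'.name
  | .optMeth t m ts t' => .meth t.name m (ts.map Ty.name) t'.name

theorem Ty.Ground.cls_name {t : Ty} (h : t.Ground) : Ty.cls t.name = t := by
  obtain ⟨C, rfl⟩ := h
  rfl

theorem map_cls_map_name {ts : List Ty} (h : ∀ t ∈ ts, t.Ground) :
    (ts.map Ty.name).map Ty.cls = ts := by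
  rw [List.map_map]
  exact (List.map_congr_left fun t ht => (h t ht).cls_name).trans (List.map_id _)

theorem map_cls_injective : Function.Injective (List.map Ty.cls) :=
  List.map_injective_iff.2 fun _ _ h => Ty.cls.inj h

/-- Groundness is what makes `CReq.toClause` faithful: `Ty.name` sends every variable to the same
default name. -/
theorem CReq.Ground.toClause_entry {r : CReq} (h : r.Ground) : r.toClause.entry = r.entry := by
  obtain ⟨h₁, h₂⟩ := h
  cases r <;> simp only [CReq.recv, CReq.signature, List.mem_cons, List.not_mem_nil, or_false,
    forall_eq_or_imp, forall_eq] at h₁ h₂ <;>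
    simp only [CReq.toClause, Clause.entry, CReq.entry, CReq.recv, CReq.key, CReq.signature,
      h₁.cls_name]
  · rw [h₂.cls_name]
  · rw [map_cls_map_name h₂]
  · rw [h₂.cls_name]
  · rw [h₂.1.cls_name, map_cls_map_name h₂.2]
  · rw [h₂.1.cls_name, map_cls_map_name h₂.2]

theorem CReq.recv_subst (σ : Subst) (r : CReq) : (r.subst σ).recv = r.recv.subst σ := by
  cases r <;> rfl

theorem CReq.key_subst (σ : Subst) (r : CReq) : (r.subst σ).key = r.key := by
  cases r <;> rfl

theorem CReq.signature_subst (σ : Subst) (r : CReq) :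
    (r.subst σ).signature = r.signature.map (Ty.subst σ) := by
  cases r <;> rfl

theorem CReq.keep_eq_or (r r' : CReq) : r.keep r' = r ∨ r.keep r' = r' := by
  cases r <;> cases r' <;> simp [CReq.keep]

/-! ### Active requirements -/

/-- The condition of the requirement holds under `σ`. -/
def Active (σ : Subst) (a : CReq × Cond) : Prop := Cond.Holds (Cond.subst σ a.2)

/-- The two requirements concern the same member of the same class under `σ`. -/
def SameMember (σ : Subst) (r r' : CReq) : Prop :=
  r.key = r'.key ∧ r.recv.subst σ = r'.recv.subst σ

/-- The entries that the requirements in `A` with a true condition ask for. -/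
def activeEntries (σ : Subst) (A : ClassReqs) : Set Entry :=
  {n | ∃ a ∈ A, Active σ a ∧ (a.1.subst σ).entry = n}

/-- Every requirement comes with one on the same member whose condition holds. -/
def Covered (σ : Subst) (A : ClassReqs) : Prop :=
  ∀ a ∈ A, ∃ a' ∈ A, Active σ a' ∧ SameMember σ a.1 a'.1

/-- There is at most one signature for each member of each class. -/
def Coherent (N : Set Entry) : Prop :=
  ∀ n ∈ N, ∀ n' ∈ N, n.1 = n'.1 → n.2.1 = n'.2.1 → n.2.2 = n'.2.2

theorem SameMember.symm {σ : Subst} {r r' : CReq} (h : SameMember σ r r') : SameMember σ r' r :=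
  ⟨h.1.symm, h.2.symm⟩

theorem SameMember.trans {σ : Subst} {r r' r'' : CReq} (h : SameMember σ r r')
    (h' : SameMember σ r' r'') : SameMember σ r r'' :=
  ⟨h.1.trans h'.1, h.2.trans h'.2⟩

theorem active_insert {σ : Subst} {r : CReq} {x : CondAtom} {c : Cond} :
    Active σ (r, insert x c) ↔ (x.subst σ).Holds ∧ Cond.Holds (Cond.subst σ c) := by
  simp [Active, Cond.Holds, Cond.subst]

theorem active_insert_union {σ : Subst} {r : CReq} {x : CondAtom} {c c' : Cond} :
    Active σ (r, insert x (c ∪ c')) ↔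
      (x.subst σ).Holds ∧ Cond.Holds (Cond.subst σ c) ∧ Cond.Holds (Cond.subst σ c') := by
  rw [active_insert]
  simp only [Cond.Holds, Cond.subst, Finset.mem_image, Finset.mem_union]
  grind

theorem mem_mergeCR {A B : ClassReqs} {x : CReq × Cond} :
    x ∈ mergeCR A B ↔ (x ∈ A ∧ ∀ b ∈ B, x.1.key ≠ b.1.key) ∨
      (x ∈ B ∧ ∀ a ∈ A, a.1.key ≠ x.1.key) ∨
      ∃ a ∈ A, ∃ b ∈ B, a.1.key = b.1.key ∧ x ∈ mergePair a b := by
  simp only [mergeCR, Finset.mem_union, Finset.mem_filter, Finset.mem_biUnion, Finset.mem_product,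
    Prod.exists]
  grind

theorem mem_mergePair {a b x : CReq × Cond} :
    x ∈ mergePair a b ↔ x = (a.1, insert (.neq a.1.recv b.1.recv) a.2) ∨
      x = (b.1, insert (.neq a.1.recv b.1.recv) b.2) ∨
      x = (a.1.keep b.1, insert (.eq a.1.recv b.1.recv) (a.2 ∪ b.2)) := by
  simp [mergePair]

/-- Merging introduces no new requirements, and no condition becomes weaker. -/
theorem exists_of_mem_mergeCR (σ : Subst) {A B : ClassReqs} {x : CReq × Cond}
    (hx : x ∈ mergeCR A B) :
    ∃ a, (a ∈ A ∨ a ∈ B) ∧ a.1 = x.1 ∧ (Active σ x → Active σ a) := by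
  rcases mem_mergeCR.1 hx with ⟨h, -⟩ | ⟨h, -⟩ | ⟨a, ha, b, hb, -, h⟩
  · exact ⟨x, .inl h, rfl, id⟩
  · exact ⟨x, .inr h, rfl, id⟩
  · rcases mem_mergePair.1 h with rfl | rfl | rfl
    · exact ⟨a, .inl ha, rfl, fun h => (active_insert.1 h).2⟩
    · exact ⟨b, .inr hb, rfl, fun h => (active_insert.1 h).2⟩
    · rcases a.1.keep_eq_or b.1 with h | h
      · exact ⟨a, .inl ha, h.symm, fun h => (active_insert_union.1 h).2.1⟩
      · exact ⟨b, .inr hb, h.symm, fun h => (active_insert_union.1 h).2.2⟩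

/-- Equal receivers activate each componentwise constraint. For unequal lengths the constraint is
that the receivers differ, which contradicts `ht`. -/
theorem map_subst_eq_of_solves_seqEqIf {Sg : SubclassRel} {σ : Subst} {ts ts' : List Ty}
    {t t' : Ty} (h : Solves Sg (seqEqIf ts ts' t t') σ) (ht : t.subst σ = t'.subst σ) :
    ts.map (Ty.subst σ) = ts'.map (Ty.subst σ) := by
  by_cases hl : ts.length = ts'.length
  · rw [seqEqIf, if_pos hl] at h
    refine List.ext_getElem (by simpa using hl) fun i h₁ h₂ => ?_
    rw [List.length_map] at h₁ h₂
    have hp : (ts[i], ts'[i]) ∈ ts.zip ts' := by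
      rw [← List.getElem_zip (i := i) (h := by simp; omega)]
      exact List.getElem_mem _
    have := h _ ⟨_, hp, rfl⟩
    simpa [Sat, Cond.subst, Cond.Holds, CondAtom.subst, CondAtom.Holds, ht] using this
  · rw [seqEqIf, if_neg hl] at h
    exact absurd ht (h _ rfl)

/-! ### Merging as union of active entries -/

section Merge

variable {Sg : SubclassRel} {σ : Subst} {A B : ClassReqs}

/-- The merge constraints test only equality of receivers and ignore the conditions attached to `a`
and `b`, so no activity assumption is needed. -/
theorem entry_eq_of_solves_merge (h : Solves Sg (mergeCRConstraints A B) σ) {a b : CReq × Cond}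
    (ha : a ∈ A) (hb : b ∈ B) (hab : SameMember σ a.1 b.1) :
    (a.1.subst σ).entry = (b.1.subst σ).entry := by
  have hs : (a.1.signature.map (Ty.subst σ)) = b.1.signature.map (Ty.subst σ) :=
    map_subst_eq_of_solves_seqEqIf (fun s hs => h s ⟨a, ha, b, hb, hab.1, hs⟩) hab.2
  simp only [CReq.entry, CReq.recv_subst, CReq.key_subst, CReq.signature_subst, hab.1, hab.2, hs]

theorem sameMember_of_entry_eq {r r' : CReq} (h : (r.subst σ).entry = (r'.subst σ).entry) :
    SameMember σ r r' := by
  simp only [CReq.entry, CReq.recv_subst, CReq.key_subst, Prod.mk.injEq] at h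
  exact ⟨h.2.1, h.1⟩

/-- An active requirement survives as one with the same entry if it meets an active one. -/
theorem exists_active_keep (h : Solves Sg (mergeCRConstraints A B) σ) {a b : CReq × Cond}
    (ha : a ∈ A) (hb : b ∈ B) (hab : SameMember σ a.1 b.1) (hac : Active σ a)
    (hbc : Active σ b) :
    ∃ x ∈ mergeCR A B, Active σ x ∧ (x.1.subst σ).entry = (a.1.subst σ).entry := by
  refine ⟨(a.1.keep b.1, insert (.eq a.1.recv b.1.recv) (a.2 ∪ b.2)),
    mem_mergeCR.2 (.inr (.inr ⟨a, ha, b, hb, hab.1, mem_mergePair.2 (.inr (.inr rfl))⟩)),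
    (active_insert_union (x := .eq _ _)).2 ⟨hab.2, hac, hbc⟩, ?_⟩
  rcases a.1.keep_eq_or b.1 with h' | h'
  · simp only [h']
  · simp only [h', entry_eq_of_solves_merge h ha hb hab]

/-- Coverage is needed only of the opposite side, where an inactive overlapping requirement could
otherwise suppress `a`. -/
theorem activeEntries_left_subset_mergeCR (hB : Covered σ B)
    (h : Solves Sg (mergeCRConstraints A B) σ) :
    activeEntries σ A ⊆ activeEntries σ (mergeCR A B) := by
  rintro _ ⟨a, ha, hac, rfl⟩
  by_cases h₀ : ∀ b ∈ B, a.1.key ≠ b.1.key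
  · exact ⟨a, mem_mergeCR.2 (.inl ⟨ha, h₀⟩), hac, rfl⟩
  push Not at h₀
  obtain ⟨b, hb, hk⟩ := h₀
  by_cases hr : a.1.recv.subst σ = b.1.recv.subst σ
  -- If `b` is inactive, nothing made from the pair `a`, `b` is active; pair `a` with an active
  -- companion of `b` instead.
  · obtain ⟨b', hb', hbc, hbb⟩ := hB b hb
    exact exists_active_keep h ha hb' (SameMember.trans ⟨hk, hr⟩ hbb) hac hbc
  -- The added inequation holds because the receivers differ, and the condition of `b` does not
  -- enter this copy of `a`.
  · exact ⟨(a.1, insert (.neq a.1.recv b.1.recv) a.2),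
      mem_mergeCR.2 (.inr (.inr ⟨a, ha, b, hb, hk, mem_mergePair.2 (.inl rfl)⟩)),
      (active_insert (x := .neq _ _)).2 ⟨hr, hac⟩, rfl⟩

theorem activeEntries_right_subset_mergeCR (hA : Covered σ A)
    (h : Solves Sg (mergeCRConstraints A B) σ) :
    activeEntries σ B ⊆ activeEntries σ (mergeCR A B) := by
  rintro _ ⟨b, hb, hbc, rfl⟩
  by_cases h₀ : ∀ a ∈ A, a.1.key ≠ b.1.key
  · exact ⟨b, mem_mergeCR.2 (.inr (.inl ⟨hb, h₀⟩)), hbc, rfl⟩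
  push Not at h₀
  obtain ⟨a, ha, hk⟩ := h₀
  by_cases hr : a.1.recv.subst σ = b.1.recv.subst σ
  · obtain ⟨a', ha', hac, haa⟩ := hA a ha
    have hab : SameMember σ a'.1 b.1 := haa.symm.trans ⟨hk, hr⟩
    rw [← entry_eq_of_solves_merge h ha' hb hab]
    exact exists_active_keep h ha' hb hab hac hbc
  · exact ⟨(b.1, insert (.neq a.1.recv b.1.recv) b.2),
      mem_mergeCR.2 (.inr (.inr ⟨a, ha, b, hb, hk, mem_mergePair.2 (.inr (.inl rfl))⟩)),
      (active_insert (x := .neq _ _)).2 ⟨hr, hbc⟩, rfl⟩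

theorem activeEntries_mergeCR (hA : Covered σ A) (hB : Covered σ B)
    (h : Solves Sg (mergeCRConstraints A B) σ) :
    activeEntries σ (mergeCR A B) = activeEntries σ A ∪ activeEntries σ B := by
  refine Set.Subset.antisymm ?_ (Set.union_subset (activeEntries_left_subset_mergeCR hB h)
    (activeEntries_right_subset_mergeCR hA h))
  rintro _ ⟨x, hx, hxc, rfl⟩
  obtain ⟨a, ha, hax, hac⟩ := exists_of_mem_mergeCR σ hx
  rw [← hax]
  exact ha.imp (fun ha => ⟨a, ha, hac hxc, rfl⟩) (fun ha => ⟨a, ha, hac hxc, rfl⟩)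

/-- Each merged requirement stems from one side and has an active companion there. The companion
itself may change in the merge, but its entry stays active, and an entry determines the member. -/
theorem Covered.mergeCR (hA : Covered σ A) (hB : Covered σ B)
    (h : Solves Sg (mergeCRConstraints A B) σ) : Covered σ (mergeCR A B) := by
  intro x hx
  obtain ⟨a, ha, hax, -⟩ := exists_of_mem_mergeCR σ hx
  obtain ⟨a', ha', hac, haa⟩ : ∃ a', (a' ∈ A ∨ a' ∈ B) ∧ Active σ a' ∧ SameMember σ a.1 a'.1 := by
    rcases ha with ha | ha
    · obtain ⟨a', h₁, h₂⟩ := hA a ha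
      exact ⟨a', .inl h₁, h₂⟩
    · obtain ⟨a', h₁, h₂⟩ := hB a ha
      exact ⟨a', .inr h₁, h₂⟩
  have hmem : (a'.1.subst σ).entry ∈ activeEntries σ (CoFJ.mergeCR A B) := by
    rw [activeEntries_mergeCR hA hB h]
    exact ha'.imp (fun ha => ⟨a', ha, hac, rfl⟩) (fun ha => ⟨a', ha, hac, rfl⟩)
  obtain ⟨y, hy, hyc, hye⟩ := hmem
  exact ⟨y, hy, hyc, hax ▸ haa.trans (sameMember_of_entry_eq hye).symm⟩

theorem Coherent.mergeCR (hA : Covered σ A) (hB : Covered σ B)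
    (hA' : Coherent (activeEntries σ A)) (hB' : Coherent (activeEntries σ B))
    (h : Solves Sg (mergeCRConstraints A B) σ) :
    Coherent (activeEntries σ (mergeCR A B)) := by
  have key : ∀ n ∈ activeEntries σ A, ∀ n' ∈ activeEntries σ B, n.1 = n'.1 → n.2.1 = n'.2.1 →
      n.2.2 = n'.2.2 := by
    rintro _ ⟨a, ha, -, rfl⟩ _ ⟨b, hb, -, rfl⟩ h₁ h₂
    simp only [CReq.entry, CReq.recv_subst, CReq.key_subst] at h₁ h₂
    rw [entry_eq_of_solves_merge h ha hb ⟨h₂, h₁⟩]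
  rw [activeEntries_mergeCR hA hB h]
  rintro n (hn | hn) n' (hn' | hn') h₁ h₂
  · exact hA' n hn n' hn' h₁ h₂
  · exact key n hn n' hn' h₁ h₂
  · exact (key n' hn' n hn h₁.symm h₂.symm).symm
  · exact hB' n hn n' hn' h₁ h₂

/-- Requirements that are covered and have coherent active entries. -/
def WellFormed (σ : Subst) (A : ClassReqs) : Prop :=
  Covered σ A ∧ Coherent (activeEntries σ A)

theorem wellFormed_empty : WellFormed σ ∅ := by
  constructor
  · intro a ha
    simp at ha
  · rintro _ ⟨a, ha, -⟩
    simp at ha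

theorem activeEntries_empty : activeEntries σ ∅ = ∅ := by
  simp [activeEntries]

theorem activeEntries_singleton (r : CReq) :
    activeEntries σ {(r, ∅)} = {(r.subst σ).entry} := by
  ext n
  simp [activeEntries, Active, Cond.Holds, Cond.subst, eq_comm]

theorem wellFormed_singleton (r : CReq) : WellFormed σ {(r, ∅)} := by
  constructor
  · intro a ha
    refine ⟨a, ha, ?_, rfl, rfl⟩
    rw [Finset.mem_singleton.1 ha]
    simp [Active, Cond.Holds, Cond.subst]
  · rw [activeEntries_singleton]
    rintro n rfl n' rfl - -
    rfl

/-- The union formula for one merge needs both sides covered, so well-formedness and the description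
of the entries are iterated together. -/
theorem mergeCRFrom_wellFormed (Bs : List ClassReqs) (hA : WellFormed σ A)
    (hBs : ∀ B ∈ Bs, WellFormed σ B) (h : Solves Sg (mergeCRFrom A Bs).2 σ) :
    WellFormed σ (mergeCRFrom A Bs).1 ∧
      ∀ n, n ∈ activeEntries σ (mergeCRFrom A Bs).1 ↔
        n ∈ activeEntries σ A ∨ ∃ B ∈ Bs, n ∈ activeEntries σ B := by
  induction Bs generalizing A with
  | nil => exact ⟨hA, by simp [mergeCRFrom]⟩
  | cons B Bs ih =>
    have hB := hBs B List.mem_cons_self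
    have hc : Solves Sg (mergeCRConstraints A B) σ := fun s hs => h s (.inl hs)
    obtain ⟨h₁, h₂⟩ := ih ⟨hA.1.mergeCR hB.1 hc, Coherent.mergeCR hA.1 hB.1 hA.2 hB.2 hc⟩
      (fun B' hB' => hBs B' (List.mem_cons_of_mem _ hB')) (fun s hs => h s (.inr hs))
    refine ⟨h₁, fun n => (h₂ n).trans ?_⟩
    rw [activeEntries_mergeCR hA.1 hB.1 hc]
    simp [or_assoc]

theorem mergeCRs_wellFormed {Bs : List ClassReqs}
    (hBs : ∀ B ∈ Bs, WellFormed σ B) (h : Solves Sg (mergeCRs Bs).2 σ) :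
    WellFormed σ (mergeCRs Bs).1 ∧
      ∀ n, n ∈ activeEntries σ (mergeCRs Bs).1 ↔ ∃ B ∈ Bs, n ∈ activeEntries σ B := by
  obtain ⟨h₁, h₂⟩ := mergeCRFrom_wellFormed Bs wellFormed_empty hBs h
  exact ⟨h₁, fun n => (h₂ n).trans (by simp [activeEntries_empty])⟩

/-! ### Merging of context requirements -/

theorem mergeRFrom_spec (Rs : List CtxReqs) (R : CtxReqs)
    (h : Solves Sg (mergeRFrom R Rs).2 σ) :
    ∀ R' ∈ R :: Rs, ∀ x t, R' x = some t →
      ∃ t', (mergeRFrom R Rs).1 x = some t' ∧ t'.subst σ = t.subst σ := by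
  induction Rs generalizing R with
  | nil =>
    intro R' hR' x t ht
    rw [List.mem_singleton.1 hR'] at ht
    exact ⟨t, ht, rfl⟩
  | cons R₁ Rs ih =>
    have ih := ih (mergeR R R₁) (fun s hs => h s (.inr hs))
    intro R' hR' x t ht
    rcases List.mem_cons.1 hR' with rfl | hR'
    · exact ih _ List.mem_cons_self x t (by simp [mergeR, ht])
    rcases List.mem_cons.1 hR' with rfl | hR'
    · cases hx : R x with
      | none => exact ih _ List.mem_cons_self x t (by simp [mergeR, hx, ht])
      | some t₀ =>
        -- The left-biased union drops `t` in favour of `t₀`; the merge constraint identifies them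
        -- under `σ`.
        obtain ⟨t', h₁, h₂⟩ := ih _ List.mem_cons_self x t₀ (by simp [mergeR, hx])
        exact ⟨t', h₁, h₂.trans (h _ (.inl ⟨x, t₀, t, hx, ht, rfl⟩))⟩
    · exact ih R' (List.mem_cons_of_mem _ hR') x t ht

theorem mergeRs_spec {Rs : List CtxReqs} (h : Solves Sg (mergeRs Rs).2 σ) :
    ∀ R ∈ Rs, ∀ x t, R x = some t →
      ∃ t', (mergeRs Rs).1 x = some t' ∧ t'.subst σ = t.subst σ :=
  fun R hR => mergeRFrom_spec Rs _ h R (List.mem_cons_of_mem _ hR)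

end Merge

/-! ### Soundness of co-contextual expression typing -/

theorem mem_allCons {os : List Output} {o : Output} (h : o ∈ os) : o.cons ⊆ allCons os :=
  fun _ hs => ⟨o, h, hs⟩

theorem forall_mem_of_forall_mem_zip {es : List Expr} {os : List Output}
    (hl : es.length = os.length) {P : Output → Prop} (h : ∀ p ∈ es.zip os, P p.2) :
    ∀ o ∈ os, P o := by
  intro o ho
  obtain ⟨i, hi, rfl⟩ := List.getElem_of_mem ho
  have hi' : i < (es.zip os).length := by simp; omega
  simpa using h _ (List.getElem_mem hi')

theorem wellFormed_map_creqs {Sg : SubclassRel} {σ : Subst} {es : List Expr} {os : List Output}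
    (hl : es.length = os.length)
    (ih : ∀ p ∈ es.zip os, Solves Sg p.2.cons σ → WellFormed σ p.2.creqs)
    (h : Solves Sg (allCons os) σ) : ∀ A ∈ os.map Output.creqs, WellFormed σ A := by
  intro A hA
  obtain ⟨o, ho, rfl⟩ := List.mem_map.1 hA
  exact forall_mem_of_forall_mem_zip (P := fun o => Solves Sg o.cons σ → WellFormed σ o.creqs)
    hl ih o ho fun s hs => h s (mem_allCons ho hs)

theorem CoExpr.wellFormed {Sg : SubclassRel} {σ : Subst} {e : Expr} {o : Output}
    (he : CoExpr e o) (h : Solves Sg o.cons σ) : WellFormed σ o.creqs := by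
  induction he with
  | ref => exact wellFormed_empty
  | field _ _ ih =>
    refine (mergeCRs_wellFormed ?_ (fun s hs => h s (.inr hs))).1
    simpa using ⟨ih fun s hs => h s (.inl hs), wellFormed_singleton _⟩
  | invk _ hl _ _ _ _ _ hcrs ih ihs =>
    refine (mergeCRs_wellFormed ?_ (fun s hs => h s (.inr hs))).1
    subst hcrs
    simp only [List.forall_mem_cons]
    exact ⟨ih fun s hs => h s (.inl (.inl (.inl (.inr hs)))), wellFormed_singleton _,
      wellFormed_map_creqs hl ihs fun s hs => h s (.inl (.inl (.inl (.inl hs))))⟩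
  | new hl _ _ _ _ _ hcrs ihs =>
    refine (mergeCRs_wellFormed ?_ (fun s hs => h s (.inr hs))).1
    subst hcrs
    simp only [List.forall_mem_cons]
    exact ⟨wellFormed_singleton _,
      wellFormed_map_creqs hl ihs fun s hs => h s (.inl (.inl (.inl hs)))⟩
  | ucast _ ih => exact ih fun s hs => h s (.inl hs)
  | dcast _ ih => exact ih fun s hs => h s (.inl (.inl hs))
  | scast _ ih => exact ih fun s hs => h s (.inl (.inl hs))

/-- The class table declares the entries in `N`; in particular, these are ground. -/
def Provides (CT : ClassTable) (N : Set Entry) : Prop :=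
  ∀ n ∈ N, ∃ c ∈ CT, c.entry = n

/-- The context binds the required variables to the required types. -/
def Meets (σ : Subst) (Γ : Ctx) (R : CtxReqs) : Prop :=
  ∀ x t, R x = some t → ∃ C, t.subst σ = .cls C ∧ Γ x = some C

theorem Provides.mono {CT : ClassTable} {N N' : Set Entry} (h : Provides CT N) (hN : N' ⊆ N) :
    Provides CT N' :=
  fun n hn => h n (hN hn)

theorem Meets.of_mergeRs {Sg : SubclassRel} {σ : Subst} {Γ : Ctx} {Rs : List CtxReqs}
    (h : Meets σ Γ (mergeRs Rs).1) (hs : Solves Sg (mergeRs Rs).2 σ) :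
    ∀ R ∈ Rs, Meets σ Γ R := by
  intro R hR x t ht
  obtain ⟨t', h₁, h₂⟩ := mergeRs_spec hs R hR x t ht
  rw [← h₂]
  exact h x t' h₁

/-- Clauses mention class names only, so finding the entry in the table also shows that its types
are ground. The three analogues below serve the same purpose. -/
theorem Provides.field {CT : ClassTable} {N : Set Entry} (h : Provides CT N) {t t' : Ty}
    {f : FieldName} (hn : (t, MemberKey.field f, [t']) ∈ N) :
    ∃ C D, t = .cls C ∧ t' = .cls D ∧ Clause.field C f D ∈ CT := by
  obtain ⟨c, hc, he⟩ := h _ hn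
  cases c <;> simp only [Clause.entry, Prod.mk.injEq, reduceCtorEq, false_and, and_false,
    MemberKey.field.injEq, List.cons.injEq, and_true] at he
  obtain ⟨rfl, rfl, rfl⟩ := he
  exact ⟨_, _, rfl, rfl, hc⟩

theorem Provides.meth {CT : ClassTable} {N : Set Entry} (h : Provides CT N) {t t' : Ty}
    {m : MethodName} {ts : List Ty} (hn : (t, MemberKey.meth m, t' :: ts) ∈ N) :
    ∃ C Ds D, t = .cls C ∧ ts = Ds.map .cls ∧ t' = .cls D ∧ Clause.meth C m Ds D ∈ CT := by
  obtain ⟨c, hc, he⟩ := h _ hn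
  cases c <;> simp only [Clause.entry, Prod.mk.injEq, reduceCtorEq, false_and, and_false,
    MemberKey.meth.injEq, List.cons.injEq] at he
  obtain ⟨rfl, rfl, rfl, rfl⟩ := he
  exact ⟨_, _, _, rfl, rfl, rfl, hc⟩

theorem Provides.ctor {CT : ClassTable} {N : Set Entry} (h : Provides CT N) {t : Ty}
    {ts : List Ty} (hn : (t, MemberKey.ctor, ts) ∈ N) :
    ∃ C Ds, t = .cls C ∧ ts = Ds.map .cls ∧ Clause.ctor C Ds ∈ CT := by
  obtain ⟨c, hc, he⟩ := h _ hn
  cases c <;> simp only [Clause.entry, Prod.mk.injEq, reduceCtorEq, false_and, and_false,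
    true_and] at he
  obtain ⟨rfl, rfl⟩ := he
  exact ⟨_, _, rfl, rfl, hc⟩

theorem Provides.ext {CT : ClassTable} {N : Set Entry} (h : Provides CT N) {t t' : Ty}
    (hn : (t, MemberKey.ext, [t']) ∈ N) :
    ∃ C D, t = .cls C ∧ t' = .cls D ∧ Clause.ext C D ∈ CT := by
  obtain ⟨c, hc, he⟩ := h _ hn
  cases c <;> simp only [Clause.entry, Prod.mk.injEq, reduceCtorEq, false_and, and_false,
    true_and, List.cons.injEq, and_true] at he
  obtain ⟨rfl, rfl⟩ := he
  exact ⟨_, _, rfl, rfl, hc⟩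

/-- Typed arguments whose types satisfy the subtype constraints fit the parameter types. -/
theorem exists_argument_types {CT : ClassTable} {Γ : Ctx} {σ : Subst} {es : List Expr}
    {os : List Output} {Us : List ClassVar} {Ds : List ClassName}
    (hl : es.length = os.length) (hU : Us.length = es.length)
    (ih : ∀ p ∈ es.zip os, ∃ C, p.2.ty.subst σ = .cls C ∧ HasType CT Γ p.1 C)
    (hsub : Solves CT.extRel (argCons os Us) σ)
    (hD : (Us.map Ty.var).map (Ty.subst σ) = Ds.map .cls) :
    ∃ Cs : List ClassName, es.length = Cs.length ∧ (∀ p ∈ es.zip Cs, HasType CT Γ p.1 p.2) ∧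
      List.Forall₂ (IsSubtype CT.extRel) Cs Ds := by
  have hDl : Us.length = Ds.length := by simpa using congrArg List.length hD
  have hty : ∀ i (h₁ : i < es.length) (h₂ : i < os.length),
      ∃ C, os[i].ty.subst σ = .cls C ∧ HasType CT Γ es[i] C := by
    intro i h₁ h₂
    have hi : i < (es.zip os).length := by simp; omega
    simpa using ih _ (List.getElem_mem hi)
  have hname : ∀ i (h₁ : i < es.length) (h₂ : i < os.length),
      os[i].ty.subst σ = .cls (os[i].ty.subst σ).name ∧
        HasType CT Γ es[i] (os[i].ty.subst σ).name := by
    intro i h₁ h₂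
    obtain ⟨C, hC, ht⟩ := hty i h₁ h₂
    rw [hC]
    exact ⟨rfl, ht⟩
  -- The argument types are those assigned by `σ`; by `hname` the default of `Ty.name` does not
  -- occur.
  refine ⟨os.map fun o => (o.ty.subst σ).name, by simpa using hl, ?_, ?_⟩
  · intro p hp
    obtain ⟨i, hi, rfl⟩ := List.getElem_of_mem hp
    have hi' : i < es.length ∧ i < os.length := by simpa using hi
    simpa using (hname i hi'.1 hi'.2).2
  · rw [List.forall₂_iff_get]
    refine ⟨by simp; omega, fun i h₁ h₂ => ?_⟩
    have h₁' : i < os.length := by simpa using h₁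
    have hi : i < (os.zip Us).length := by simp; omega
    have hs := hsub _ ⟨_, List.getElem_mem hi, rfl⟩
    have hDi : σ (Us[i]'(by omega)) = .cls Ds[i] := by
      have := List.getElem_of_eq hD (i := i) (by simp; omega)
      simpa [Ty.subst] using this
    obtain ⟨C, D, hC, hD', hCD⟩ := hs
    simp only [List.getElem_zip] at hC
    simp only [List.getElem_zip, Ty.subst, hDi, Ty.cls.injEq] at hD'
    subst hD'
    have hn : (os[i].ty.subst σ).name = C := by rw [hC]; rfl
    simpa [hn] using hCD

/-- The table and the context stay fixed in the induction: whatever they supply for the merged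
requirements they supply for each subderivation. Consistency of the table plays no part here. -/
theorem CoExpr.hasType {CT : ClassTable} {Γ : Ctx} {σ : Subst} {e : Expr} {o : Output}
    (he : CoExpr e o) (h : Solves CT.extRel o.cons σ)
    (hCT : Provides CT (activeEntries σ o.creqs)) (hΓ : Meets σ Γ o.reqs) :
    ∃ C, o.ty.subst σ = .cls C ∧ HasType CT Γ e C := by
  induction he with
  | @ref x U =>
    obtain ⟨C, h₁, h₂⟩ := hΓ x (.var U) (by simp)
    exact ⟨C, h₁, .ref h₂⟩
  | @field e f o U he _ ih =>
    have ho : Solves CT.extRel o.cons σ := fun s hs => h s (.inl hs)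
    have hm := (mergeCRs_wellFormed (by simpa using ⟨he.wellFormed ho, wellFormed_singleton _⟩)
      (fun s hs => h s (.inr hs))).2
    obtain ⟨C, hC, ht⟩ := ih ho (hCT.mono fun n hn => (hm n).2 ⟨_, by simp, hn⟩) hΓ
    obtain ⟨C', D, hC', hD, hcl⟩ := hCT.field (t := o.ty.subst σ) (f := f) (t' := σ U)
      ((hm _).2 ⟨{(.field o.ty f (.var U), ∅)}, by simp, by
        rw [activeEntries_singleton]; rfl⟩)
    obtain rfl := Ty.cls.inj (hC.symm.trans hC')
    exact ⟨D, hD, .field ht (.here hcl)⟩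
  | @invk e m es o os U' Us crs he hl hes _ hU _ _ hcrs ih ihs =>
    have ho : Solves CT.extRel o.cons σ := fun s hs => h s (.inl (.inl (.inl (.inr hs))))
    have hos : Solves CT.extRel (allCons os) σ :=
      fun s hs => h s (.inl (.inl (.inl (.inl hs))))
    subst hcrs
    have hm := (mergeCRs_wellFormed (by
      simp only [List.forall_mem_cons]
      exact ⟨he.wellFormed ho, wellFormed_singleton _,
        wellFormed_map_creqs hl (fun p hp => (hes p hp).wellFormed) hos⟩)
      (fun s hs => h s (.inr hs))).2
    have hR := hΓ.of_mergeRs (fun s hs => h s (.inl (.inr hs)))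
    obtain ⟨C, hC, ht⟩ := ih ho (hCT.mono fun n hn => (hm n).2 ⟨_, by simp, hn⟩)
      (hR _ (by simp))
    obtain ⟨C', Ds, D, hC', hDs, hD, hcl⟩ := hCT.meth (t := o.ty.subst σ) (m := m) (t' := σ U')
      (ts := (Us.map Ty.var).map (Ty.subst σ))
      ((hm _).2 ⟨{(.meth o.ty m (Us.map Ty.var) (.var U'), ∅)}, by simp, by
        rw [activeEntries_singleton]; rfl⟩)
    obtain rfl := Ty.cls.inj (hC.symm.trans hC')
    obtain ⟨Cs, h₁, h₂, h₃⟩ := exists_argument_types hl hU (fun p hp => ihs p hp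
      (fun s hs => hos s (mem_allCons (List.of_mem_zip hp).2 hs))
      (hCT.mono fun n hn => (hm n).2 ⟨p.2.creqs, by
        have := List.mem_map_of_mem (f := Output.creqs) (List.of_mem_zip hp).2
        exact List.mem_cons_of_mem _ (List.mem_cons_of_mem _ this), hn⟩)
      (hR _ (List.mem_cons_of_mem _ (List.mem_map_of_mem (List.of_mem_zip hp).2))))
      (fun s hs => h s (.inl (.inl (.inr hs)))) hDs
    exact ⟨D, hD, .invk ht h₁ h₂ (.here hcl) h₃⟩
  | @new C es os Us crs hl hes _ hU _ _ hcrs ihs =>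
    have hos : Solves CT.extRel (allCons os) σ := fun s hs => h s (.inl (.inl (.inl hs)))
    subst hcrs
    have hm := (mergeCRs_wellFormed (by
      simp only [List.forall_mem_cons]
      exact ⟨wellFormed_singleton _,
        wellFormed_map_creqs hl (fun p hp => (hes p hp).wellFormed) hos⟩)
      (fun s hs => h s (.inr hs))).2
    have hR := hΓ.of_mergeRs (fun s hs => h s (.inl (.inr hs)))
    obtain ⟨C', Ds, hC', hDs, hcl⟩ := hCT.ctor (t := .cls C)
      (ts := (Us.map Ty.var).map (Ty.subst σ))
      ((hm _).2 ⟨{(.ctor (.cls C) (Us.map Ty.var), ∅)}, by simp, by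
        rw [activeEntries_singleton]; rfl⟩)
    obtain rfl := Ty.cls.inj hC'
    obtain ⟨Cs, h₁, h₂, h₃⟩ := exists_argument_types hl hU (fun p hp => ihs p hp
      (fun s hs => hos s (mem_allCons (List.of_mem_zip hp).2 hs))
      (hCT.mono fun n hn => (hm n).2 ⟨p.2.creqs, by
        have := List.mem_map_of_mem (f := Output.creqs) (List.of_mem_zip hp).2
        exact List.mem_cons_of_mem _ this, hn⟩)
      (hR _ (List.mem_map_of_mem (List.of_mem_zip hp).2)))
      (fun s hs => h s (.inl (.inl (.inr hs)))) hDs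
    exact ⟨C, rfl, .new h₁ h₂ hcl h₃⟩
  | @ucast C e o _ ih =>
    obtain ⟨D, hD, ht⟩ := ih (fun s hs => h s (.inl hs)) hCT hΓ
    obtain ⟨D', C', hD', hC', hs⟩ := h _ (.inr rfl)
    obtain rfl := Ty.cls.inj (hD.symm.trans hD')
    obtain rfl := Ty.cls.inj hC'
    exact ⟨C, rfl, .ucast ht hs⟩
  | @dcast C e o _ ih =>
    obtain ⟨D, hD, ht⟩ := ih (fun s hs => h s (.inl (.inl hs))) hCT hΓ
    obtain ⟨C', D', hC', hD', hs⟩ := h _ (.inl (.inr rfl))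
    obtain rfl := Ty.cls.inj (hD.symm.trans hD')
    obtain rfl := Ty.cls.inj hC'
    have hne : Ty.cls C ≠ o.ty.subst σ := h _ (.inr rfl)
    exact ⟨C, rfl, .dcast ht hs fun hCD => hne (by rw [hD, hCD])⟩
  | @scast C e o _ ih =>
    obtain ⟨D, hD, ht⟩ := ih (fun s hs => h s (.inl (.inl hs))) hCT hΓ
    have h₁ : ¬ Ty.Sub CT.extRel (.cls C) (o.ty.subst σ) := h _ (.inl (.inr rfl))
    have h₂ : ¬ Ty.Sub CT.extRel (o.ty.subst σ) (.cls C) := h _ (.inr rfl)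
    -- `Ty.Sub` fails on non-ground types, so the negated constraints speak about subclassing only
    -- because `hD` makes the type of `e` a class name.
    exact ⟨C, rfl, .scast ht (fun hs => h₁ ⟨C, D, rfl, hD, hs⟩)
      fun hs => h₂ ⟨D, C, hD, rfl, hs⟩⟩

/-! ### The class table of a set of requirements -/

open Classical in
/-- The class table with superclasses `Sg` that declares, in each class itself, the members that
the requirements with a true condition ask for. An optional method is declared as well: otherwise
its class might inherit the method with another signature. -/
noncomputable def tableOf (Sg : SubclassRel) (CR : ClassReqs) : ClassTable :=
  Sg.image (fun p => Clause.ext p.1 p.2) ∪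
    (CR.filter fun r => Cond.Holds r.2).image fun r => r.1.toClause

theorem mem_tableOf {Sg : SubclassRel} {CR : ClassReqs} {c : Clause} :
    c ∈ tableOf Sg CR ↔ (∃ C D, (C, D) ∈ Sg ∧ Clause.ext C D = c) ∨
      ∃ r ∈ CR, Cond.Holds r.2 ∧ r.1.toClause = c := by
  simp [tableOf, and_assoc]

theorem mem_extRel {CT : ClassTable} {C D : ClassName} :
    (C, D) ∈ CT.extRel ↔ Clause.ext C D ∈ CT := by
  simp only [ClassTable.extRel, Finset.mem_biUnion]
  constructor
  · rintro ⟨c, hc, h⟩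
    cases c <;> simp [Clause.ext?] at h
    obtain ⟨rfl, rfl⟩ := h
    exact hc
  · exact fun h => ⟨_, h, by simp [Clause.ext?]⟩

section Table

variable {Sg : SubclassRel} {CR : ClassReqs} {σ : Subst}

theorem toClause_mem_tableOf {r : CReq × Cond} (hr : r ∈ CR) (hc : Cond.Holds r.2) :
    r.1.toClause ∈ tableOf Sg CR :=
  mem_tableOf.2 (.inr ⟨r, hr, hc, rfl⟩)

theorem provides_tableOf (hG : (CR.subst σ).Ground) :
    Provides (tableOf Sg (CR.subst σ)) (activeEntries σ CR) := by
  rintro _ ⟨a, ha, hac, rfl⟩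
  have hmem : (a.1.subst σ, Cond.subst σ a.2) ∈ CR.subst σ := Finset.mem_image_of_mem _ ha
  exact ⟨_, toClause_mem_tableOf hmem hac, (hG _ hmem).1.toClause_entry⟩

theorem mem_tableOf_subst (hG : (CR.subst σ).Ground) {c : Clause}
    (hc : c ∈ tableOf Sg (CR.subst σ)) :
    (∃ C D, (C, D) ∈ Sg ∧ Clause.ext C D = c) ∨ c.entry ∈ activeEntries σ CR := by
  rcases mem_tableOf.1 hc with h | ⟨r, hr, hrc, rfl⟩
  · exact .inl h
  · rw [(hG r hr).1.toClause_entry]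
    obtain ⟨a, ha, rfl⟩ := Finset.mem_image.1 hr
    exact .inr ⟨a, ha, hrc, rfl⟩

/-- Active `extends` requirements also become clauses; `hext` says that they add no pair to `Sg`. -/
theorem extRel_tableOf (hG : CR.Ground) (hext : InheritanceIn Sg CR) :
    (tableOf Sg CR).extRel = Sg := by
  ext ⟨C, D⟩
  rw [mem_extRel, mem_tableOf]
  constructor
  · rintro (⟨C', D', h, hcl⟩ | ⟨r, hr, hc, hcl⟩)
    · cases hcl
      exact h
    · have hg := (hG r hr).1
      refine hext r hr hc C D ?_
      have he := hg.toClause_entry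
      rw [hcl] at he
      -- The key in the entry rules out all but `extends` requirements.
      cases h : r.1 <;> rw [h] at he <;>
        simp [Clause.entry, CReq.entry, CReq.recv, CReq.key, CReq.signature] at he
      rw [← he.1, ← he.2]
  · exact fun h => .inl ⟨C, D, h, rfl⟩

theorem consistent_tableOf (hG : (CR.subst σ).Ground) (hCR : Coherent (activeEntries σ CR)) :
    (tableOf Sg (CR.subst σ)).Consistent := by
  constructor
  · intro C Ds Ds' h h'
    rcases mem_tableOf_subst hG h with ⟨_, _, _, hc⟩ | h
    · cases hc
    rcases mem_tableOf_subst hG h' with ⟨_, _, _, hc⟩ | h'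
    · cases hc
    exact map_cls_injective (hCR _ h _ h' rfl rfl)
  · intro C f D D' h h'
    rcases mem_tableOf_subst hG h with ⟨_, _, _, hc⟩ | h
    · cases hc
    rcases mem_tableOf_subst hG h' with ⟨_, _, _, hc⟩ | h'
    · cases hc
    simpa [Clause.entry] using hCR _ h _ h' rfl rfl
  · intro C m Ds Ds' D D' h h'
    rcases mem_tableOf_subst hG h with ⟨_, _, _, hc⟩ | h
    · cases hc
    rcases mem_tableOf_subst hG h' with ⟨_, _, _, hc⟩ | h'
    · cases hc
    have := hCR _ h _ h' rfl rfl
    simp only [Clause.entry, List.cons.injEq, Ty.cls.injEq] at this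
    exact ⟨map_cls_injective this.2, this.1⟩

end Table

/-- A method declared in a class itself has no other type there. -/
theorem ClassTable.Consistent.mtype_unique {CT : ClassTable} (h : CT.Consistent)
    {m : MethodName} {C D D' : ClassName} {Ds Ds' : List ClassName}
    (hcl : Clause.meth C m Ds D ∈ CT) (ht : MType CT m C Ds' D') : Ds = Ds' ∧ D = D' := by
  cases ht with
  | here h' => exact h.meth _ _ _ _ _ _ hcl h'
  | up h' => exact absurd hcl (h' _ _)

/-- The clause sits in the receiver, so lookup finds it at once. Consistency matters only for
optional methods, where every possible method type has to be the declared one. -/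
theorem satisfiesReq_of_mem {CT : ClassTable} (h : CT.Consistent) {r : CReq} (hG : r.Ground)
    (hr : r.toClause ∈ CT) : SatisfiesReq CT r := by
  obtain ⟨⟨C, hC⟩, hs⟩ := hG
  cases r <;> simp only [CReq.recv, CReq.signature, List.mem_cons, List.not_mem_nil, or_false,
    forall_eq_or_imp, forall_eq] at hC hs <;> subst hC
  · exact ⟨_, _, rfl, hs.cls_name.symm, hr⟩
  · exact ⟨_, _, rfl, (map_cls_map_name hs).symm, hr⟩
  · exact ⟨_, _, rfl, hs.cls_name.symm, .here hr⟩
  · exact ⟨_, _, _, rfl, (map_cls_map_name hs.2).symm, hs.1.cls_name.symm, .here hr⟩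
  · refine ⟨_, rfl, fun Ds D ht => ?_⟩
    obtain ⟨h₁, h₂⟩ := h.mtype_unique hr ht
    exact ⟨by rw [← h₁, map_cls_map_name hs.2], by rw [← h₂, hs.1.cls_name]⟩

theorem meets_ctx {Sg : SubclassRel} {σ : Subst} {M : MethodDecl} {R : CtxReqs} {Uc : ClassVar}
    {C : ClassName} (hC : σ Uc = .cls C)
    (hdom : ∀ x, R (.param x) ≠ none → x ∈ M.params.map Prod.fst)
    (hthis : Solves Sg (thisCons Uc R) σ) (hparam : Solves Sg (paramCons M R) σ) :
    Meets σ (M.ctx C) R := by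
  rintro (_ | x) t ht
  · have h : σ Uc = t.subst σ := hthis _ ⟨t, ht, rfl⟩
    exact ⟨C, h.symm.trans hC, rfl⟩
  · have hx := hdom x (by simp [ht])
    cases hl : M.params.lookup x with
    | none =>
      rw [List.lookup_eq_none_iff] at hl
      obtain ⟨p, hp, rfl⟩ := List.mem_map.1 hx
      simpa using hl p hp
    | some D =>
      -- `paramCons` ranges over all pairs in the parameter list, hence covers the one that lookup
      -- finds, even if names repeat.
      obtain ⟨l₁, l₂, hp, -⟩ := List.lookup_eq_some_iff.1 hl
      have h : Ty.cls D = t.subst σ := hparam _ ⟨(x, D), by simp [hp], t, ht, rfl⟩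
      exact ⟨D, h.symm, hl⟩

end CoFJ

/-! ### Soundness of co-contextual method typing -/

theorem mainTheorem4 (M : CoFJ.MethodDecl) (T : CoFJ.Ty) (S : Set CoFJ.Constraint)
    (CR : CoFJ.ClassReqs) (Sg : CoFJ.SubclassRel) (σ : CoFJ.Subst)
    (hM : CoFJ.CoMethod M S T CR)
    (hσ : CoFJ.Solves Sg S σ)
    (hT : (T.subst σ).Ground)
    (hCR : (CoFJ.ClassReqs.subst σ CR).Ground)
    (hext : CoFJ.InheritanceIn Sg (CoFJ.ClassReqs.subst σ CR)) :
    ∃ (C : CoFJ.ClassName) (CT : CoFJ.ClassTable),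
      CT.Consistent ∧ CT.extRel = Sg ∧
      CoFJ.MethodOK CT C M ∧
      T.subst σ = .cls C ∧ CoFJ.Satisfies CT (CoFJ.ClassReqs.subst σ CR) := by
  open CoFJ in
  cases hM with
  | @intro o Uc Ud crs he hdom _ _ _ hcrs =>
  obtain ⟨C, hC⟩ := hT
  have ho : Solves Sg o.cons σ := fun s hs => hσ s (.inl (.inl (.inl (.inl hs))))
  subst hcrs
  obtain ⟨hwf, hm⟩ := mergeCRs_wellFormed
    (by simpa using ⟨he.wellFormed ho, wellFormed_singleton _, wellFormed_singleton _⟩)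
    (fun s hs => hσ s (.inl (.inr hs)))
  have hrel := extRel_tableOf hCR hext
  have hprov := provides_tableOf (Sg := Sg) hCR
  have hcons := consistent_tableOf (Sg := Sg) hCR hwf.2
  refine ⟨C, tableOf Sg (ClassReqs.subst σ _), hcons, hrel, ?_, hC,
    fun r hr hc => satisfiesReq_of_mem hcons (hCR r hr).1 (toClause_mem_tableOf hr hc)⟩
  obtain ⟨E₀, hE₀, ht⟩ := he.hasType (Γ := M.ctx C) (by rw [hrel]; exact ho)
    (hprov.mono fun n hn => (hm n).2 ⟨_, by simp, hn⟩)
    (meets_ctx hC hdom (fun s hs => hσ s (.inl (.inl (.inr hs)))) (fun s hs => hσ s (.inr hs)))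
  obtain ⟨E, R, hE, hR, hsub⟩ := hσ (.sub o.ty (.cls M.ret)) (.inl (.inl (.inl (.inr rfl))))
  obtain rfl := Ty.cls.inj (hE₀.symm.trans hE)
  obtain rfl := Ty.cls.inj hR
  obtain ⟨C', D, hC', hD, hcl⟩ := hprov.ext (t := σ Uc) (t' := σ Ud)
    ((hm _).2 ⟨{(.ext (.var Uc) (.var Ud), ∅)}, by simp, by rw [activeEntries_singleton]; rfl⟩)
  obtain rfl := Ty.cls.inj (hC.symm.trans hC')
  -- The optional requirement has become a method clause of the superclass `D` itself, so `D` has no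
  -- other type for this method.
  obtain ⟨D', Ds, D₀, hD', hDs, hD₀, hmeth⟩ := hprov.meth (t := σ Ud) (m := M.name)
    (ts := (M.paramTypes.map Ty.cls).map (Ty.subst σ)) (t' := .cls M.ret)
    ((hm _).2 ⟨{(.optMeth (.var Ud) M.name (M.paramTypes.map Ty.cls) (.cls M.ret), ∅)}, by simp,
      by rw [activeEntries_singleton]; rfl⟩)
  obtain rfl := Ty.cls.inj (hD.symm.trans hD')
  obtain rfl := Ty.cls.inj hD₀
  have hDs' : M.paramTypes = Ds := by
    refine map_cls_injective (Eq.trans ?_ hDs)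
    rw [List.map_map]
    rfl
  subst hDs'
  exact ⟨E₀, D, ht, by rw [hrel]; exact hsub, hcl, fun Es E hE => hcons.mtype_unique hmeth hE⟩
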